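/- For $n\ge 1$ let $z=z^{(n)}\in\{\pm1\}^n$ be an arbitrary fixed vector, and let $W=W^{(n)}$ be a random symmetric $n\times n$ matrix with $W_{ii}=0$ whose entries $W_{ij}$, $i>j$, are independent standard Gaussians. Consider the observation $Y=zz^T+\sigma W$ or, equivalently, with $\lambda=\sqrt n/\sigma$, the scaled observation $\mathcal Y=\frac{\lambda}{n}Y=\frac{\lambda}{n}zz^T+\frac{1}{\sqrt n}W$. For a symmetric cost matrix $A$ (here $A=Y$ or $A=\mathcal Y$), the rank-2 problem is $$\max\ \mathrm{Tr}(Q^TAQ)\quad\text{subject to } Q\in\mathbb R^{n\times 2},\ \|Q_{i:}\|_2^2=1\ \text{ for } 1\le i\le n,$$ where $Q_{i:}$ is the $i$-th row of $Q$. Its second-order critical points are the feasible $Q$ satisfying the first- and second-order necessary optimality conditions on the search space (a product of circles): the Riemannian gradient of the cost vanishes at $Q$ and its Riemannian Hessian at $Q$ is negative semidefinite. Equivalently, along every smooth feasible curve through $Q$, the cost has zero first derivative and nonpositive second derivative at $Q$. **Theorem.** Assume $\lambda>16$ (equivalently $0<\sigma<\frac1{16}\sqrt n$); here $\lambda=\lambda_n$,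 or $\sigma=\sigma_n$, may be constant or depend on $n$, as long as the inequality holds for every $n\ge1$. Then for every $\varepsilon>0$, with probability tending to $1$ as $n\to\infty$, all second-order critical points $Q$ of the rank-2 problem with cost matrix $\mathcal Y$ (equivalently, with cost matrix $Y$) satisfy $$\frac1n\|Q^Tz\|_2\ \ge\ 1-(1+\varepsilon)\frac{16}{\lambda}\;=\;1-(1+\varepsilon)\frac{16\sigma}{\sqrt n}.$$ -/

import Mathlib

open Filter Topology MeasureTheory ProbabilityTheory Matrix
open scoped ContDiff

noncomputable section

namespace Z2Sync

/-- Positions strictly below the diagonal of an `n × n` matrix. -/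
abbrev LowerIdx (n : ℕ) : Type := {p : Fin n × Fin n // p.2 < p.1}

/-- The joint law of the entries `W i j`, `i > j`: independent standard Gaussians. -/
def noiseLaw (n : ℕ) : Measure (LowerIdx n → ℝ) :=
  Measure.pi fun _ => gaussianReal 0 1

/-- The symmetric noise matrix with zero diagonal and given entries below the diagonal. -/
def noiseMatrix {n : ℕ} (g : LowerIdx n → ℝ) : Matrix (Fin n) (Fin n) ℝ :=
  Matrix.of fun i j =>
    if h : j < i then g ⟨(i, j), h⟩ else if h : i < j then g ⟨(j, i), h⟩ else 0

/-- The observation `Y = z zᵀ + σ W`. -/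
def obs {n : ℕ} (σ : ℝ) (z : Fin n → ℝ) (W : Matrix (Fin n) (Fin n) ℝ) :
    Matrix (Fin n) (Fin n) ℝ :=
  vecMulVec z z + σ • W

/-- The scaled observation `(lam / n) z zᵀ + (1 / √n) W`. -/
def scaledObs {n : ℕ} (lam : ℝ) (z : Fin n → ℝ) (W : Matrix (Fin n) (Fin n) ℝ) :
    Matrix (Fin n) (Fin n) ℝ :=
  (lam / (n : ℝ)) • vecMulVec z z + (1 / Real.sqrt n) • W

/-- The search space of the rank-2 problem: every row is a unit vector of `ℝ²`. -/
def Feasible {n : ℕ} (Q : Matrix (Fin n) (Fin 2) ℝ) : Prop :=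
  ∀ i, ‖WithLp.toLp 2 (Q i)‖ ^ 2 = 1

/-- The cost function `Tr(Qᵀ A Q)`, to be maximized over the search space. -/
def cost {n : ℕ} (A : Matrix (Fin n) (Fin n) ℝ) (Q : Matrix (Fin n) (Fin 2) ℝ) : ℝ :=
  (Qᵀ * A * Q).trace

/-- `c` is a smooth curve in the search space with `c 0 = Q`. -/
structure IsFeasibleCurve {n : ℕ} (c : ℝ → Matrix (Fin n) (Fin 2) ℝ)
    (Q : Matrix (Fin n) (Fin 2) ℝ) : Prop where
  smooth : ∀ i k, ContDiff ℝ ∞ fun t => c t i k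
  feasible : ∀ t, Feasible (c t)
  start : c 0 = Q

/-- `Q` satisfies the first- and second-order necessary optimality conditions for maximizing
`Tr(Qᵀ A Q)` over the search space, a product of circles. Along every smooth curve of the search
space through `Q` the cost has zero first derivative (the Riemannian gradient vanishes) and
nonpositive second derivative (the Riemannian Hessian is negative semidefinite). -/
structure IsSecondOrderCritical {n : ℕ} (A : Matrix (Fin n) (Fin n) ℝ)
    (Q : Matrix (Fin n) (Fin 2) ℝ) : Prop where
  feasible : Feasible Q
  first_order : ∀ c, IsFeasibleCurve c Q → deriv (fun t => cost A (c t)) 0 = 0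
  second_order : ∀ c, IsFeasibleCurve c Q → iteratedDeriv 2 (fun t => cost A (c t)) 0 ≤ 0

/-- The normalized correlation `‖Qᵀ z‖₂ / n`. -/
def correlation {n : ℕ} (Q : Matrix (Fin n) (Fin 2) ℝ) (z : Fin n → ℝ) : ℝ :=
  (1 / (n : ℝ)) * ‖WithLp.toLp 2 (Qᵀ *ᵥ z)‖

/-- The events `good n` about the noise matrix of size `n` hold with high probability:
the probability of failure tends to `0` as `n → ∞`. -/
def WithHighProbability (good : ∀ n : ℕ, Matrix (Fin n) (Fin n) ℝ → Prop) : Prop :=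
  Tendsto (fun n => noiseLaw n {g | ¬ good n (noiseMatrix g)}) atTop (𝓝 0)

end Z2Sync

end

namespace Z2Sync

/-! The proof splits into a deterministic statement about `p z zᵀ + B` with `‖B‖ ≤ κ` and `4κ < pn`
(`IsSecondOrderCritical.correlation_ge`), and the bound `‖W‖ ≤ 4√n` with high probability
(`noiseLaw_norm_gt_le`). Together they give `1 - 16/λ` directly.

Deterministic part: flipping signs reduces to `z = 1`. Let `q i` be the rows, `S` their sum and `R =
‖S‖`. Averaging the Hessian over the two coordinate directions gives `R² ≥ n²/2 - 2κn/p`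
(`sq_norm_sum_ge`), which keeps `R` away from zero. Criticality makes `p S + (Bq) i` a nonnegative
multiple of `q i`, so `q i` is close to the direction of `S`; summing over `i` gives `p² R² (n - R)
≤ 2κ² n`. With `m = R/n` and `t = 4κ/(pn)`, these two bounds force `m ≥ 1 - t`
(`one_sub_le_of_sq_ge_of_cubic_le`).

Noise part: a volume argument replaces a net. If `‖W‖` is large, the Rayleigh quotient is large in
absolute value on a whole ball around a top eigenvector, so the integral of its exponential over a
fixed ball is large. The expectation of that integral is controlled by the Gaussian moment
generating function, and Markov's inequality concludes. -/

/-! ### Deterministic inequalities for points on the circle. -/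

lemma quadForm_abs_le_of_sum_sq_le {n : ℕ} {B : Fin n → Fin n → ℝ} {κ : ℝ} (hκ : 0 ≤ κ)
    (hB : ∀ x : Fin n → ℝ, ∑ i, (∑ j, B i j * x j) ^ 2 ≤ κ ^ 2 * ∑ i, x i ^ 2)
    (x : Fin n → ℝ) : |∑ i, x i * ∑ j, B i j * x j| ≤ κ * ∑ i, x i ^ 2 := by
  have hS : 0 ≤ ∑ i, x i ^ 2 := Finset.sum_nonneg fun _ _ => sq_nonneg _
  refine abs_le_of_sq_le_sq ?_ (by positivity)
  calc (∑ i, x i * ∑ j, B i j * x j) ^ 2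
      ≤ (∑ i, x i ^ 2) * ∑ i, (∑ j, B i j * x j) ^ 2 :=
        Finset.sum_mul_sq_le_sq_mul_sq _ _ _
    _ ≤ (∑ i, x i ^ 2) * (κ ^ 2 * ∑ i, x i ^ 2) := mul_le_mul_of_nonneg_left (hB x) hS
    _ = (κ * ∑ i, x i ^ 2) ^ 2 := by ring

/-- The elementary inequality behind the correlation bound. -/
lemma one_sub_le_of_sq_ge_of_cubic_le {t m : ℝ} (ht : 0 ≤ t) (ht1 : t < 1) (hm : 0 ≤ m)
    (h1 : 1 / 2 - t / 2 ≤ m ^ 2) (h2 : (1 - m) * m ^ 2 ≤ t ^ 2 / 8) : 1 - t ≤ m := by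
  by_contra! h
  -- For `t ≥ 1/2`, `m² < (1 - t)² ≤ (1 - t)/2` contradicts `h1`. Otherwise `h2` yields `m² ≤ t/8 <
  -- 1/16`, while `h1` gives `m² > 1/4`; the division by `t` forces `t = 0` apart.
  rcases le_or_gt (1 / 2) t with h3 | h3
  · nlinarith
  · have h4 : t * m ^ 2 ≤ t ^ 2 / 8 := le_trans (by nlinarith [sq_nonneg m]) h2
    rcases ht.eq_or_lt with h5 | h5
    · subst h5
      have : (1 - m) * m ^ 2 > 0 := mul_pos (by linarith) (by linarith)
      linarith
    · nlinarith

/-- A projection of the second-order condition: testing with the coordinates of the points. -/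
lemma sq_norm_sum_ge {n : ℕ} {a b : Fin n → ℝ} (hab : ∀ i, a i ^ 2 + b i ^ 2 = 1)
    {B : Fin n → Fin n → ℝ} {κ p : ℝ} (hκ : 0 ≤ κ) (hp : 0 ≤ p)
    (hB : ∀ x : Fin n → ℝ, ∑ i, (∑ j, B i j * x j) ^ 2 ≤ κ ^ 2 * ∑ i, x i ^ 2)
    (h2 : ∀ u : Fin n → ℝ,
      0 ≤ ∑ i, ∑ j, (p + B i j) * (a i * a j + b i * b j) * (u i - u j) ^ 2) :
    p * ((n : ℝ) ^ 2 / 2 - ((∑ i, a i) ^ 2 + (∑ i, b i) ^ 2)) ≤ 2 * κ * n := by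
  have hn : ∑ i, a i ^ 2 + ∑ i, b i ^ 2 = n := by
    rw [← Finset.sum_add_distrib]; simp [hab]
  have hn2 : ∑ i, (a i * a i) ^ 2 + ∑ i, (a i * b i) ^ 2 + ∑ i, (a i * b i) ^ 2
      + ∑ i, (b i * b i) ^ 2 = n := by
    rw [← Finset.sum_add_distrib, ← Finset.sum_add_distrib, ← Finset.sum_add_distrib]
    rw [Finset.sum_congr rfl (g := fun _ => (1 : ℝ)) fun i _ => ?_]
    · simp
    · linear_combination (a i ^ 2 + b i ^ 2 + 1) * hab i
  -- The weights add up to `‖q i - q j‖² = 2 - 2⟨q i, q j⟩`, so the sum involves only `⟨q i, q j⟩ -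
  -- ⟨q i, q j⟩²`.
  have key := add_nonneg (h2 a) (h2 b)
  have e : ∑ i, ∑ j, (p + B i j) * (a i * a j + b i * b j) * (a i - a j) ^ 2
      + ∑ i, ∑ j, (p + B i j) * (a i * a j + b i * b j) * (b i - b j) ^ 2
      = 2 * (p * ((∑ i, a i) ^ 2 + (∑ i, b i) ^ 2
          - ((∑ i, a i ^ 2) ^ 2 + 2 * (∑ i, a i * b i) ^ 2 + (∑ i, b i ^ 2) ^ 2))
        + (∑ i, a i * ∑ j, B i j * a j) + (∑ i, b i * ∑ j, B i j * b j)
        - (∑ i, (a i * a i) * ∑ j, B i j * (a j * a j))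
        - (∑ i, (a i * b i) * ∑ j, B i j * (a j * b j))
        - (∑ i, (a i * b i) * ∑ j, B i j * (a j * b j))
        - (∑ i, (b i * b i) * ∑ j, B i j * (b j * b j))) := by
    simp only [sq (∑ i, _), Finset.sum_mul_sum]
    simp only [Finset.mul_sum, ← Finset.sum_add_distrib, ← Finset.sum_sub_distrib]
    refine Finset.sum_congr rfl fun i _ => Finset.sum_congr rfl fun j _ => ?_
    linear_combination ((p + B i j) * (a i * a j + b i * b j)) * (hab i + hab j)
  rw [e] at key
  have q := fun x => abs_le.mp (quadForm_abs_le_of_sum_sq_le hκ hB x)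
  -- The right side is the squared Frobenius norm of the 2 × 2 matrix `∑ q i (q i)ᵀ`, whose trace is
  -- `n`.
  have hlow : (n : ℝ) ^ 2 / 2
      ≤ (∑ i, a i ^ 2) ^ 2 + 2 * (∑ i, a i * b i) ^ 2 + (∑ i, b i ^ 2) ^ 2 := by
    rw [← hn]
    nlinarith [sq_nonneg (∑ i, a i * b i), sq_nonneg (∑ i, a i ^ 2 - ∑ i, b i ^ 2)]
  have q1 := (q a).2
  have q2 := (q b).2
  have q3 := (q fun i => a i * a i).1
  have q4 := (q fun i => a i * b i).1
  have q5 := (q fun i => b i * b i).1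
  have hk1 := congrArg (κ * ·) hn
  have hk2 := congrArg (κ * ·) hn2
  beta_reduce at hk1 hk2 q3 q4 q5
  have := mul_le_mul_of_nonneg_left hlow hp
  linarith

/-- If `(X + x, Y + y)` is a nonnegative multiple of the unit vector `(a, b)`, then `(a, b)` is
close to the direction of `(X, Y)`. -/
lemma dist_sq_le_of_parallel {a b X Y x y s r : ℝ} (hab : a ^ 2 + b ^ 2 = 1) (hs : 0 ≤ s)
    (hr : 0 ≤ r) (hXY : X ^ 2 + Y ^ 2 = r ^ 2) (h1 : X + x = s * a) (h2 : Y + y = s * b) :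
    (r * a - X) ^ 2 + (r * b - Y) ^ 2 ≤ 4 * (x ^ 2 + y ^ 2) := by
  have hx : x = s * a - X := by linarith
  have hy : y = s * b - Y := by linarith
  subst hx hy
  set d := a * X + b * Y with hd
  obtain ⟨hdr', hdr⟩ : -r ≤ d ∧ d ≤ r := by
    refine abs_le_of_sq_le_sq' ?_ hr
    nlinarith [sq_nonneg (a * Y - b * X)]
  have e1 : (r * a - X) ^ 2 + (r * b - Y) ^ 2 = 2 * r ^ 2 - 2 * r * d := by
    linear_combination r ^ 2 * hab + hXY
  have e2 : (s * a - X) ^ 2 + (s * b - Y) ^ 2 = s ^ 2 - 2 * s * d + r ^ 2 := by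
    linear_combination s ^ 2 * hab + hXY
  rw [e1, e2]
  -- The claim is affine in `d`, with slope `2r - 8s` for right minus left; the worst case is `d =
  -- r` or `d = -r` according to its sign.
  rcases le_total r (4 * s) with h | h
  · nlinarith [mul_nonneg (sub_nonneg.2 h) (sub_nonneg.2 hdr), sq_nonneg (s - r)]
  · nlinarith [mul_nonneg (sub_nonneg.2 h) (neg_le_iff_add_nonneg.1 hdr'), mul_nonneg hs hr]

/-- Deterministic lower bound: points `(a i, b i)` of the circle which satisfy the first- and
second-order conditions for a perturbation `B` of the constant matrix `p` are correlated. -/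
theorem mean_norm_ge {n : ℕ} (hn : 0 < n) {a b : Fin n → ℝ} (hab : ∀ i, a i ^ 2 + b i ^ 2 = 1)
    {B : Fin n → Fin n → ℝ} {κ p : ℝ} (hκ : 0 ≤ κ) (hp : 4 * κ < p * n)
    (hB : ∀ x : Fin n → ℝ, ∑ i, (∑ j, B i j * x j) ^ 2 ≤ κ ^ 2 * ∑ i, x i ^ 2)
    (hd : ∀ i, 0 ≤ p + B i i)
    (h1 : ∀ i, ∑ j, (p + B i j) * (a i * b j - b i * a j) = 0)
    (h2 : ∀ u : Fin n → ℝ,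
      0 ≤ ∑ i, ∑ j, (p + B i j) * (a i * a j + b i * b j) * (u i - u j) ^ 2)
    (h3 : ∀ i, p + B i i ≤ ∑ j, (p + B i j) * (a i * a j + b i * b j)) :
    1 - 4 * κ / (p * n) ≤ √((∑ i, a i) ^ 2 + (∑ i, b i) ^ 2) / n := by
  have hn' : (0 : ℝ) < n := by exact_mod_cast hn
  have hpn : 0 < p * n := by linarith
  have hp0 : 0 < p := pos_of_mul_pos_left hpn hn'.le
  set R := √((∑ i, a i) ^ 2 + (∑ i, b i) ^ 2) with hR
  have hR0 : 0 ≤ R := Real.sqrt_nonneg _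
  have hRsq : R ^ 2 = (∑ i, a i) ^ 2 + (∑ i, b i) ^ 2 := Real.sq_sqrt (by positivity)
  have hsum : ∑ i, a i ^ 2 + ∑ i, b i ^ 2 = n := by
    rw [← Finset.sum_add_distrib]; simp [hab]
  have hA := sq_norm_sum_ge hab hκ hp0.le hB h2
  rw [← hRsq] at hA
  have hpt : ∀ i, (p * R * a i - p * ∑ j, a j) ^ 2 + (p * R * b i - p * ∑ j, b j) ^ 2
      -- `h1` gives parallelism to `q i`; `hd` and `h3` make the multiplier nonnegative, which
      -- excludes the antipodal direction.
      ≤ 4 * ((∑ j, B i j * a j) ^ 2 + (∑ j, B i j * b j) ^ 2) := fun i => by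
    have hs : ∑ j, (p + B i j) * (a i * a j + b i * b j)
        = a i * (p * (∑ j, a j) + ∑ j, B i j * a j)
          + b i * (p * (∑ j, b j) + ∑ j, B i j * b j) := by
      simp only [Finset.mul_sum, ← Finset.sum_add_distrib]
      exact Finset.sum_congr rfl fun j _ => by ring
    have hc : a i * (p * (∑ j, b j) + ∑ j, B i j * b j)
          - b i * (p * (∑ j, a j) + ∑ j, B i j * a j) = 0 := by
      rw [← h1 i]
      simp only [Finset.mul_sum, ← Finset.sum_add_distrib, ← Finset.sum_sub_distrib]
      exact Finset.sum_congr rfl fun j _ => by ring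
    refine dist_sq_le_of_parallel (hab i) ((hd i).trans (h3 i)) (by positivity)
      (by linear_combination -p ^ 2 * hRsq) ?_ ?_ <;> rw [hs]
    · linear_combination -(p * (∑ j, a j) + ∑ j, B i j * a j) * hab i - b i * hc
    · linear_combination -(p * (∑ j, b j) + ∑ j, B i j * b j) * hab i + a i * hc
  have hC := Finset.sum_le_sum fun i (_ : i ∈ Finset.univ) => hpt i
  rw [← Finset.mul_sum, Finset.sum_add_distrib (g := fun i => (∑ j, B i j * b j) ^ 2)] at hC
  have hL : ∑ i, ((p * R * a i - p * ∑ j, a j) ^ 2 + (p * R * b i - p * ∑ j, b j) ^ 2)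
      = 2 * p ^ 2 * R ^ 2 * (n - R) := by
    have : ∀ i, (p * R * a i - p * ∑ j, a j) ^ 2 + (p * R * b i - p * ∑ j, b j) ^ 2
        = 2 * p ^ 2 * R ^ 2 - 2 * p ^ 2 * R * (∑ j, a j) * a i
          - 2 * p ^ 2 * R * (∑ j, b j) * b i := fun i => by
      linear_combination p ^ 2 * R ^ 2 * hab i - p ^ 2 * hRsq
    rw [Finset.sum_congr rfl fun i _ => this i, Finset.sum_sub_distrib, Finset.sum_sub_distrib,
      Finset.sum_const, ← Finset.mul_sum, ← Finset.mul_sum]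
    simp only [Finset.card_univ, Fintype.card_fin, nsmul_eq_mul]
    linear_combination 2 * p ^ 2 * R * hRsq
  rw [hL] at hC
  have hD : 2 * p ^ 2 * R ^ 2 * (n - R) ≤ 4 * κ ^ 2 * n := by
    have hκn := congrArg (κ ^ 2 * ·) hsum
    beta_reduce at hκn
    linarith [hB a, hB b]
  refine one_sub_le_of_sq_ge_of_cubic_le (by positivity) ((div_lt_one hpn).2 hp)
    (by positivity) ?_ ?_
  · have : (1 / 2 - 4 * κ / (p * n) / 2) = (p * (n ^ 2 / 2) - 2 * κ * n) / (p * n ^ 2) := by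
      field_simp
      ring
    rw [this, div_pow, div_le_div_iff₀ (by positivity) (by positivity)]
    nlinarith [mul_le_mul_of_nonneg_right hA (sq_nonneg (n : ℝ))]
  · have e1 : (1 - R / n) * (R / n) ^ 2 = (2 * p ^ 2 * R ^ 2 * (n - R)) / (2 * p ^ 2 * n ^ 3) := by
      field_simp
    have e2 : (4 * κ / (p * n)) ^ 2 / 8 = (4 * κ ^ 2 * n) / (2 * p ^ 2 * n ^ 3) := by
      field_simp
      ring
    rw [e1, e2]
    gcongr

/-! ### Optimality conditions along rotations of the rows. -/

/-- The curve which rotates the row `i` of `Q` by the angle `t * u i`. -/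
noncomputable def rotatedRows {n : ℕ} (Q : Matrix (Fin n) (Fin 2) ℝ) (u : Fin n → ℝ) (t : ℝ) :
    Matrix (Fin n) (Fin 2) ℝ :=
  Matrix.of fun i => ![Q i 0 * Real.cos (t * u i) - Q i 1 * Real.sin (t * u i),
    Q i 0 * Real.sin (t * u i) + Q i 1 * Real.cos (t * u i)]

lemma feasible_iff {n : ℕ} {Q : Matrix (Fin n) (Fin 2) ℝ} :
    Feasible Q ↔ ∀ i, Q i 0 ^ 2 + Q i 1 ^ 2 = 1 := by
  simp [Feasible, EuclideanSpace.norm_sq_eq]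

lemma isFeasibleCurve_rotatedRows {n : ℕ} {Q : Matrix (Fin n) (Fin 2) ℝ} (hQ : Feasible Q)
    (u : Fin n → ℝ) : IsFeasibleCurve (rotatedRows Q u) Q where
  smooth i k := by
    fin_cases k <;> simp only [rotatedRows, Matrix.of_apply] <;> simp <;> fun_prop
  feasible t := feasible_iff.2 fun i => by
    simp only [rotatedRows, Matrix.of_apply, Matrix.cons_val_zero, Matrix.cons_val_one]
    linear_combination (Real.sin (t * u i) ^ 2 + Real.cos (t * u i) ^ 2) * feasible_iff.1 hQ i
      + Real.sin_sq_add_cos_sq (t * u i)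
  start := by
    ext i k
    fin_cases k <;> simp [rotatedRows]

lemma cost_eq_sum {n : ℕ} (A : Matrix (Fin n) (Fin n) ℝ) (Q : Matrix (Fin n) (Fin 2) ℝ) :
    cost A Q = ∑ i, ∑ j, A i j * (Q i 0 * Q j 0 + Q i 1 * Q j 1) := by
  simp only [cost, Matrix.trace, Matrix.diag_apply, Matrix.mul_apply, Matrix.transpose_apply,
    Fin.sum_univ_two, Finset.sum_mul, ← Finset.sum_add_distrib]
  rw [Finset.sum_comm]
  exact Finset.sum_congr rfl fun i _ => Finset.sum_congr rfl fun j _ => by ring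

lemma cost_rotatedRows {n : ℕ} (A : Matrix (Fin n) (Fin n) ℝ) (Q : Matrix (Fin n) (Fin 2) ℝ)
    (u : Fin n → ℝ) (t : ℝ) :
    cost A (rotatedRows Q u t) = ∑ i, ∑ j, A i j *
      ((Q i 0 * Q j 0 + Q i 1 * Q j 1) * Real.cos (t * (u i - u j))
        + (Q i 0 * Q j 1 - Q i 1 * Q j 0) * Real.sin (t * (u i - u j))) := by
  rw [cost_eq_sum]
  refine Finset.sum_congr rfl fun i _ => Finset.sum_congr rfl fun j _ => ?_
  simp only [rotatedRows, Matrix.of_apply, Matrix.cons_val_zero, Matrix.cons_val_one, mul_sub,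
    Real.cos_sub, Real.sin_sub]
  ring

lemma hasDerivAt_cos_add_sin (α β w t : ℝ) :
    HasDerivAt (fun t => α * Real.cos (t * w) + β * Real.sin (t * w))
      ((β * w) * Real.cos (t * w) + (-(α * w)) * Real.sin (t * w)) t := by
  have h : HasDerivAt (fun t : ℝ => t * w) w t := by simpa using (hasDerivAt_id t).mul_const w
  refine ((h.cos.const_mul α).fun_add (h.sin.const_mul β)).congr_deriv ?_
  ring

lemma deriv_cost_rotatedRows {n : ℕ} (A : Matrix (Fin n) (Fin n) ℝ)
    (Q : Matrix (Fin n) (Fin 2) ℝ) (u : Fin n → ℝ) :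
    deriv (fun t => cost A (rotatedRows Q u t)) = fun t => ∑ i, ∑ j, A i j *
      (((Q i 0 * Q j 1 - Q i 1 * Q j 0) * (u i - u j)) * Real.cos (t * (u i - u j))
        + (-((Q i 0 * Q j 0 + Q i 1 * Q j 1) * (u i - u j))) * Real.sin (t * (u i - u j))) := by
  funext t
  simp only [cost_rotatedRows]
  exact (HasDerivAt.fun_sum fun i _ => HasDerivAt.fun_sum fun j _ =>
    (hasDerivAt_cos_add_sin _ _ _ t).const_mul _).deriv

lemma iteratedDeriv_two_cost_rotatedRows {n : ℕ} (A : Matrix (Fin n) (Fin n) ℝ)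
    (Q : Matrix (Fin n) (Fin 2) ℝ) (u : Fin n → ℝ) :
    iteratedDeriv 2 (fun t => cost A (rotatedRows Q u t)) 0
      = -∑ i, ∑ j, A i j * (Q i 0 * Q j 0 + Q i 1 * Q j 1) * (u i - u j) ^ 2 := by
  rw [iteratedDeriv_succ, iteratedDeriv_one, deriv_cost_rotatedRows]
  refine (HasDerivAt.fun_sum fun i _ => HasDerivAt.fun_sum fun j _ =>
    (hasDerivAt_cos_add_sin _ _ _ 0).const_mul _).deriv.trans ?_
  simp only [← Finset.sum_neg_distrib]
  refine Finset.sum_congr rfl fun i _ => Finset.sum_congr rfl fun j _ => ?_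
  simp
  ring

lemma IsSecondOrderCritical.laplacian_nonneg {n : ℕ} {A : Matrix (Fin n) (Fin n) ℝ}
    {Q : Matrix (Fin n) (Fin 2) ℝ} (h : IsSecondOrderCritical A Q) (u : Fin n → ℝ) :
    0 ≤ ∑ i, ∑ j, A i j * (Q i 0 * Q j 0 + Q i 1 * Q j 1) * (u i - u j) ^ 2 := by
  have := h.second_order _ (isFeasibleCurve_rotatedRows h.feasible u)
  rw [iteratedDeriv_two_cost_rotatedRows] at this
  linarith

/-- Rotating one row alone changes only the terms in its row and column. Used with `φ = id` for the
gradient and `φ = (· ^ 2)` for the Hessian. -/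
lemma sum_sum_single_sub {n : ℕ} (f : Fin n → Fin n → ℝ) (φ : ℝ → ℝ) (hφ : φ 0 = 0)
    (k : Fin n) :
    ∑ i, ∑ j, f i j * φ (Pi.single (M := fun _ => ℝ) k 1 i - Pi.single (M := fun _ => ℝ) k 1 j)
      = φ 1 * (∑ j, f k j - f k k) + φ (-1) * (∑ i, f i k - f k k) := by
  have hk : ∀ i j : Fin n,
      f i j * φ (Pi.single (M := fun _ => ℝ) k 1 i - Pi.single (M := fun _ => ℝ) k 1 j)
      = (if i = k then φ 1 * f i j else 0) + (if j = k then φ (-1) * f i j else 0)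
        - (if i = k then if j = k then (φ 1 + φ (-1)) * f i j else 0 else 0) := fun i j => by
    by_cases hi : i = k <;> by_cases hj : j = k <;> simp [hi, hj, hφ] <;> ring
  simp only [hk, Finset.sum_add_distrib, Finset.sum_sub_distrib]
  rw [Finset.sum_comm (f := fun i j => if i = k then φ 1 * f i j else 0)]
  simp [← Finset.mul_sum]
  ring

lemma IsSecondOrderCritical.cross_eq_zero {n : ℕ} {A : Matrix (Fin n) (Fin n) ℝ}
    (hA : A.IsSymm) {Q : Matrix (Fin n) (Fin 2) ℝ} (h : IsSecondOrderCritical A Q) (k : Fin n) :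
    ∑ j, A k j * (Q k 0 * Q j 1 - Q k 1 * Q j 0) = 0 := by
  have := h.first_order _ (isFeasibleCurve_rotatedRows h.feasible (Pi.single k 1))
  rw [deriv_cost_rotatedRows] at this
  simp only [zero_mul, Real.cos_zero, Real.sin_zero, mul_one, mul_zero, add_zero, ← mul_assoc]
    at this
  have e0 := sum_sum_single_sub (fun i j => A i j * (Q i 0 * Q j 1 - Q i 1 * Q j 0)) id rfl k
  simp only [id_eq] at e0
  rw [e0] at this
  have e : ∑ i, A i k * (Q i 0 * Q k 1 - Q i 1 * Q k 0)
      = -∑ j, A k j * (Q k 0 * Q j 1 - Q k 1 * Q j 0) := by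
    rw [← Finset.sum_neg_distrib]
    exact Finset.sum_congr rfl fun i _ => by rw [hA.apply]; ring
  rw [e] at this
  linarith

lemma IsSecondOrderCritical.diag_le {n : ℕ} {A : Matrix (Fin n) (Fin n) ℝ}
    (hA : A.IsSymm) {Q : Matrix (Fin n) (Fin 2) ℝ} (h : IsSecondOrderCritical A Q) (k : Fin n) :
    A k k ≤ ∑ j, A k j * (Q k 0 * Q j 0 + Q k 1 * Q j 1) := by
  have := h.laplacian_nonneg (Pi.single k 1)
  rw [sum_sum_single_sub (fun i j => A i j * (Q i 0 * Q j 0 + Q i 1 * Q j 1)) (· ^ 2)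
    (by norm_num)] at this
  have e : ∑ i, A i k * (Q i 0 * Q k 0 + Q i 1 * Q k 1)
      = ∑ j, A k j * (Q k 0 * Q j 0 + Q k 1 * Q j 1) :=
    Finset.sum_congr rfl fun i _ => by rw [hA.apply]; ring
  rw [e] at this
  have hk : A k k * (Q k 0 * Q k 0 + Q k 1 * Q k 1) = A k k := by
    linear_combination A k k * feasible_iff.1 h.feasible k
  rw [hk] at this
  linarith

/-! ### Reduction to the all-ones signal. -/

/-- Second-order critical points for a perturbation of `p z zᵀ` of operator norm at most `κ`
are correlated with `z`. -/
theorem IsSecondOrderCritical.correlation_ge {n : ℕ} (hn : 0 < n) {z : Fin n → ℝ}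
    (hz : ∀ i, z i = 1 ∨ z i = -1) {B : Matrix (Fin n) (Fin n) ℝ} (hBs : B.IsSymm)
    (hBd : ∀ i, B i i = 0) {κ p : ℝ} (hκ : 0 ≤ κ) (hp : 4 * κ < p * n)
    (hB : ∀ x : Fin n → ℝ, ∑ i, (∑ j, B i j * x j) ^ 2 ≤ κ ^ 2 * ∑ i, x i ^ 2)
    {Q : Matrix (Fin n) (Fin 2) ℝ} (hQ : IsSecondOrderCritical (p • vecMulVec z z + B) Q) :
    1 - 4 * κ / (p * n) ≤ correlation Q z := by
  have hn' : (0 : ℝ) < n := by exact_mod_cast hn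
  have hp0 : 0 < p := pos_of_mul_pos_left (by linarith) hn'.le
  have hz2 : ∀ i, z i * z i = 1 := fun i => by rcases hz i with h | h <;> simp [h]
  have hA : ∀ i j, (p • vecMulVec z z + B) i j = p * (z i * z j) + B i j := fun i j => by
    simp [vecMulVec_apply]
  have hAs : (p • vecMulVec z z + B).IsSymm := Matrix.IsSymm.ext fun i j => by
    rw [hA, hA, hBs.apply]; ring
  -- Conjugation by `diag z` turns `z zᵀ` into the all-ones matrix and preserves the norm bound on
  -- `B`.
  have hmain := mean_norm_ge hn (a := fun i => z i * Q i 0) (b := fun i => z i * Q i 1)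
    (B := fun i j => z i * z j * B i j) (κ := κ) (p := p) ?_ hκ hp ?_ ?_ ?_ ?_ ?_
  · convert hmain using 1
    rw [correlation, EuclideanSpace.norm_eq, one_div, inv_mul_eq_div]
    simp [Matrix.mulVec, dotProduct, mul_comm]
  · intro i
    linear_combination feasible_iff.1 hQ.feasible i + (Q i 0 ^ 2 + Q i 1 ^ 2) * hz2 i
  · intro x
    have h := hB fun j => z j * x j
    have e1 : ∀ i, (∑ j, z i * z j * B i j * x j) ^ 2 = (∑ j, B i j * (z j * x j)) ^ 2 :=
      fun i => by
        have : ∑ j, z i * z j * B i j * x j = z i * ∑ j, B i j * (z j * x j) := by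
          rw [Finset.mul_sum]; exact Finset.sum_congr rfl fun j _ => by ring
        rw [this]
        linear_combination (∑ j, B i j * (z j * x j)) ^ 2 * hz2 i
    have e2 : ∀ i, (z i * x i) ^ 2 = x i ^ 2 := fun i => by
      linear_combination x i ^ 2 * hz2 i
    simpa only [e1, e2] using h
  · intro i
    simp [hBd, hp0.le]
  · intro i
    rw [← hQ.cross_eq_zero hAs i]
    refine Finset.sum_congr rfl fun j _ => ?_
    rw [hA]
    linear_combination B i j * (Q i 0 * Q j 1 - Q i 1 * Q j 0)
      * ((z j * z j) * hz2 i + hz2 j)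
  · intro u
    refine (hQ.laplacian_nonneg u).trans_eq
      (Finset.sum_congr rfl fun i _ => Finset.sum_congr rfl fun j _ => ?_)
    rw [hA]
    linear_combination -(B i j * (Q i 0 * Q j 0 + Q i 1 * Q j 1) * (u i - u j) ^ 2)
      * ((z j * z j) * hz2 i + hz2 j)
  · intro i
    have h := hQ.diag_le hAs i
    rw [hA, hBd, hz2] at h
    simp only [hBd, mul_zero, add_zero]
    rw [mul_one, add_zero] at h
    refine h.trans_eq (Finset.sum_congr rfl fun j _ => ?_)
    rw [hA]
    linear_combination -(B i j * (Q i 0 * Q j 0 + Q i 1 * Q j 1))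
      * ((z j * z j) * hz2 i + hz2 j)

/-! ### Quadratic forms of the Gaussian noise. -/

lemma noiseMatrix_isSymm {n : ℕ} (g : LowerIdx n → ℝ) : (noiseMatrix g).IsSymm :=
  Matrix.IsSymm.ext fun i j => by
    rcases lt_trichotomy i j with h | h | h
    · simp [noiseMatrix, h, h.not_gt]
    · simp [h]
    · simp [noiseMatrix, h, h.not_gt]

lemma noiseMatrix_diag {n : ℕ} (g : LowerIdx n → ℝ) (i : Fin n) : noiseMatrix g i i = 0 := by
  simp [noiseMatrix]

lemma quadForm_noiseMatrix {n : ℕ} (g : LowerIdx n → ℝ) (x : Fin n → ℝ) :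
    ∑ i, ∑ j, noiseMatrix g i j * (x i * x j)
      = 2 * ∑ p : LowerIdx n, g p * (x p.1.1 * x p.1.2) := by
  set G : Fin n → Fin n → ℝ := fun i j => if h : j < i then g ⟨(i, j), h⟩ else 0 with hG
  have h1 : ∀ i j, noiseMatrix g i j = G i j + G j i := fun i j => by
    rcases lt_trichotomy i j with h | h | h
    · simp [noiseMatrix, hG, h, h.not_gt]
    · simp [noiseMatrix, hG, h]
    · simp [noiseMatrix, hG, h, h.not_gt]
  have h2 : ∑ i, ∑ j, G j i * (x i * x j) = ∑ i, ∑ j, G i j * (x i * x j) := by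
    rw [Finset.sum_comm]
    exact Finset.sum_congr rfl fun i _ => Finset.sum_congr rfl fun j _ => by ring
  have h3 : ∑ i, ∑ j, G i j * (x i * x j) = ∑ p : LowerIdx n, g p * (x p.1.1 * x p.1.2) := by
    rw [← Fintype.sum_prod_type' (f := fun i j => G i j * (x i * x j)),
      ← Finset.sum_filter_add_sum_filter_not Finset.univ (fun p : Fin n × Fin n => p.2 < p.1),
      Finset.sum_eq_zero (s := Finset.univ.filter fun p : Fin n × Fin n => ¬ p.2 < p.1),
      add_zero, Finset.sum_subtype _ (p := fun p : Fin n × Fin n => p.2 < p.1) (by simp)]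
    · refine Finset.sum_congr rfl fun p _ => ?_
      simp [hG, p.2]
    · intro p hp
      simp only [Finset.mem_filter, Finset.mem_univ, true_and] at hp
      simp [hG, hp]
  simp only [h1, add_mul, Finset.sum_add_distrib]
  rw [h2, h3]
  ring

lemma lintegral_exp_linear_noiseLaw (n : ℕ) (c : LowerIdx n → ℝ) :
    ∫⁻ g, ENNReal.ofReal (Real.exp (∑ p, c p * g p)) ∂noiseLaw n
      = ENNReal.ofReal (Real.exp (∑ p, c p ^ 2 / 2)) := by
  have hmgf : ∀ p, ∫ y, Real.exp (c p * y) ∂gaussianReal 0 1 = Real.exp (c p ^ 2 / 2) :=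
    fun p => by
      have := mgf_gaussianReal (p := gaussianReal 0 1) (X := id) (μ := 0) (v := 1)
        (by simp) (c p)
      simpa [mgf] using this
  rw [← ofReal_integral_eq_lintegral_ofReal]
  · simp only [Real.exp_sum, noiseLaw]
    rw [integral_fintype_prod_eq_prod (fun p y => Real.exp (c p * y))]
    simp only [hmgf]
  · simp only [Real.exp_sum, noiseLaw]
    exact Integrable.fintype_prod fun p => integrable_exp_mul_gaussianReal _
  · exact Filter.Eventually.of_forall fun g => (Real.exp_pos _).le

/-- The quadratic form of the noise matrix is sub-Gaussian in every direction. -/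
lemma lintegral_exp_quadForm_le {n : ℕ} (s : ℝ) {x : Fin n → ℝ} (hx : ∑ i, x i ^ 2 ≤ 1) :
    ∫⁻ g, ENNReal.ofReal (Real.exp (s * ∑ i, ∑ j, noiseMatrix g i j * (x i * x j))) ∂noiseLaw n
      ≤ ENNReal.ofReal (Real.exp (s ^ 2)) := by
  have e : ∀ g : LowerIdx n → ℝ, s * ∑ i, ∑ j, noiseMatrix g i j * (x i * x j)
      = ∑ p : LowerIdx n, (2 * s * (x p.1.1 * x p.1.2)) * g p := fun g => by
    rw [quadForm_noiseMatrix, Finset.mul_sum, Finset.mul_sum]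
    exact Finset.sum_congr rfl fun p _ => by ring
  simp only [e]
  rw [lintegral_exp_linear_noiseLaw]
  refine ENNReal.ofReal_le_ofReal (Real.exp_le_exp.2 ?_)
  -- Taking the entries `x i * x j` themselves as noise evaluates the variance sum over `i > j` as
  -- half a full off-diagonal sum.
  have h1 := quadForm_noiseMatrix (fun p : LowerIdx n => x p.1.1 * x p.1.2) x
  have h2 : ∑ i, ∑ j, noiseMatrix (fun p : LowerIdx n => x p.1.1 * x p.1.2) i j * (x i * x j)
      ≤ ∑ i, ∑ j, x i ^ 2 * x j ^ 2 := by
    refine Finset.sum_le_sum fun i _ => Finset.sum_le_sum fun j _ => ?_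
    rcases lt_trichotomy i j with h | h | h
    · simp only [noiseMatrix, Matrix.of_apply, h, h.not_gt, dite_true, dite_false]
      exact le_of_eq (by ring)
    · simp only [h, noiseMatrix_diag, zero_mul]; positivity
    · simp only [noiseMatrix, Matrix.of_apply, h, dite_true]
      exact le_of_eq (by ring)
  rw [← Finset.sum_mul_sum] at h2
  have h3 : ∑ p : LowerIdx n, (2 * s * (x p.1.1 * x p.1.2)) ^ 2 / 2
      = s ^ 2 * (2 * ∑ p : LowerIdx n, x p.1.1 * x p.1.2 * (x p.1.1 * x p.1.2)) := by
    rw [Finset.mul_sum, Finset.mul_sum]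
    exact Finset.sum_congr rfl fun p _ => by ring
  rw [h3, ← h1]
  have h4 : (∑ i, x i ^ 2) * ∑ i, x i ^ 2 ≤ 1 :=
    mul_le_one₀ hx (Finset.sum_nonneg fun _ _ => sq_nonneg _) hx
  nlinarith [sq_nonneg s]

/-! ### Symmetric operators near a top eigenvector. -/

section Spectral
variable {E : Type*} [NormedAddCommGroup E] [InnerProductSpace ℝ E] {T : E →ₗ[ℝ] E}

/-- The operator norm of a symmetric operator is attained at an eigenvector. -/
lemma exists_norm_eigenvector [FiniteDimensional ℝ E] [Nontrivial E] (hT : T.IsSymmetric) :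
    ∃ (L : ℝ) (v : E), 0 ≤ L ∧ (∀ x, ‖T x‖ ≤ L * ‖x‖) ∧ ‖v‖ = 1 ∧
      (T v = L • v ∨ T v = -(L • v)) := by
  set n := Module.finrank ℝ E with hn
  have : Nonempty (Fin n) := Fin.pos_iff_nonempty.1 Module.finrank_pos
  set e := hT.eigenvectorBasis hn.symm
  set l := hT.eigenvalues hn.symm
  have hTe : ∀ i, T (e i) = l i • e i := fun i =>
    hT.apply_eigenvectorBasis hn.symm i
  obtain ⟨i, hi⟩ := Finite.exists_max fun i => |l i|
  refine ⟨|l i|, e i, abs_nonneg _, fun x => ?_, e.norm_eq_one i, ?_⟩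
  · refine le_of_sq_le_sq ?_ (by positivity)
    rw [mul_pow, ← e.sum_sq_norm_inner_right, ← e.sum_sq_norm_inner_right x, Finset.mul_sum]
    refine Finset.sum_le_sum fun j _ => ?_
    rw [← hT, hTe, inner_smul_left, norm_mul, mul_pow]
    gcongr
    simpa using hi j
  · rcases abs_choice (l i) with h | h <;> rw [h, hTe]
    · exact Or.inl rfl
    · right; simp

lemma inner_ge_of_mem_ball (hT : T.IsSymmetric) {L : ℝ} (hL : 0 ≤ L)
    (hTL : ∀ x, ‖T x‖ ≤ L * ‖x‖) {v : E} (hv : ‖v‖ = 1) (hTv : T v = L • v) {x : E}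
    (hx : x ∈ Metric.ball v (1 / 4)) : 7 / 9 * L * ‖x‖ ^ 2 ≤ inner ℝ (T x) x := by
  obtain ⟨w, rfl⟩ : ∃ w, x = v + w := ⟨x - v, by simp⟩
  rw [mem_ball_iff_norm, add_sub_cancel_left] at hx
  have h1 : inner ℝ (T (v + w)) (v + w) = L * ‖v + w‖ ^ 2 - L * ‖w‖ ^ 2 + inner ℝ (T w) w := by
    have h2 : inner ℝ (T w) v = L * inner ℝ w v := by rw [hT, hTv, inner_smul_right]
    rw [map_add, inner_add_left, inner_add_right, inner_add_right, h2, hTv, inner_smul_left,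
      inner_smul_left, norm_add_sq_real, real_inner_self_eq_norm_sq, real_inner_comm v w]
    simp only [RCLike.conj_to_real]
    ring
  -- The total loss is at most `2L‖w‖²`; since `‖w‖ < 1/4` and `‖v + w‖ ≥ 3/4`, this costs the
  -- fraction `2/9`.
  have h2 : -(L * ‖w‖ ^ 2) ≤ inner ℝ (T w) w := by
    have := (abs_le.1 (abs_real_inner_le_norm (T w) w)).1
    nlinarith [hTL w, norm_nonneg w]
  have h3 : 3 / 4 ≤ ‖v + w‖ := by
    have := norm_sub_le (v + w) w
    rw [add_sub_cancel_right, hv] at this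
    linarith
  have h4 : ‖w‖ ^ 2 ≤ 1 / 9 * ‖v + w‖ ^ 2 := by nlinarith [norm_nonneg w]
  rw [h1]
  nlinarith [mul_le_mul_of_nonneg_left h4 hL]

end Spectral

/-! ### Operator norm of the noise by a volume argument. -/

/-- The Rayleigh quotient of the noise matrix in the direction of `x`. -/
noncomputable def rayleigh {n : ℕ} (g : LowerIdx n → ℝ) (x : EuclideanSpace ℝ (Fin n)) : ℝ :=
  ∑ i, ∑ j, noiseMatrix g i j * ((x i / ‖x‖) * (x j / ‖x‖))

/-- Twice the hyperbolic cosine of a multiple of the Rayleigh quotient. -/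
noncomputable def expRayleigh {n : ℕ} (s : ℝ) (g : LowerIdx n → ℝ)
    (x : EuclideanSpace ℝ (Fin n)) : ENNReal :=
  ENNReal.ofReal (Real.exp (s * rayleigh g x)) + ENNReal.ofReal (Real.exp (-s * rayleigh g x))

lemma measurable_expRayleigh (n : ℕ) (s : ℝ) :
    Measurable fun q : (LowerIdx n → ℝ) × EuclideanSpace ℝ (Fin n) =>
      expRayleigh s q.1 q.2 := by
  have h : Measurable fun q : (LowerIdx n → ℝ) × EuclideanSpace ℝ (Fin n) =>
      rayleigh q.1 q.2 := by
    simp only [rayleigh, quadForm_noiseMatrix _ fun i => _ / _]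
    fun_prop
  unfold expRayleigh
  fun_prop

instance (n : ℕ) : IsProbabilityMeasure (noiseLaw n) := by
  unfold noiseLaw; infer_instance

lemma lintegral_expRayleigh_le {n : ℕ} (s : ℝ) (x : EuclideanSpace ℝ (Fin n)) :
    ∫⁻ g, expRayleigh s g x ∂noiseLaw n ≤ ENNReal.ofReal (2 * Real.exp (s ^ 2)) := by
  -- Only an inequality, since the sum is `0` at `x = 0`.
  have hx : ∑ i, (x i / ‖x‖) ^ 2 ≤ 1 := by
    simp only [div_pow]
    rw [← Finset.sum_div, EuclideanSpace.real_norm_sq_eq]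
    exact div_self_le_one _
  have hm : Measurable fun g : LowerIdx n → ℝ =>
      ENNReal.ofReal (Real.exp (s * rayleigh g x)) := by
    simp only [rayleigh, quadForm_noiseMatrix _ fun i => _ / _]
    fun_prop
  unfold expRayleigh
  rw [lintegral_add_left hm, two_mul, ENNReal.ofReal_add (Real.exp_pos _).le (Real.exp_pos _).le]
  refine add_le_add (lintegral_exp_quadForm_le s hx) ?_
  exact (lintegral_exp_quadForm_le (-s) hx).trans_eq (by rw [neg_sq])

lemma inner_toEuclideanLin {n : ℕ} (W : Matrix (Fin n) (Fin n) ℝ)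
    (x : EuclideanSpace ℝ (Fin n)) :
    inner ℝ (W.toEuclideanLin x) x = ∑ i, ∑ j, W i j * (x i * x j) := by
  simp only [PiLp.inner_apply, Matrix.toLpLin_apply, Matrix.mulVec, dotProduct]
  refine Finset.sum_congr rfl fun i _ => ?_
  simp only [RCLike.inner_apply, RCLike.conj_to_real, Finset.mul_sum]
  exact Finset.sum_congr rfl fun j _ => by ring

lemma inner_eq_rayleigh {n : ℕ} (g : LowerIdx n → ℝ) (x : EuclideanSpace ℝ (Fin n)) :
    inner ℝ ((noiseMatrix g).toEuclideanLin x) x = rayleigh g x * ‖x‖ ^ 2 := by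
  rw [inner_toEuclideanLin, rayleigh, Finset.sum_mul]
  refine Finset.sum_congr rfl fun i _ => ?_
  rw [Finset.sum_mul]
  refine Finset.sum_congr rfl fun j _ => ?_
  rcases eq_or_ne x 0 with rfl | hx
  · simp
  · have : ‖x‖ ≠ 0 := norm_ne_zero_iff.2 hx
    field_simp

lemma isSymmetric_toEuclideanLin {n : ℕ} {W : Matrix (Fin n) (Fin n) ℝ} (hW : W.IsSymm) :
    W.toEuclideanLin.IsSymmetric := by
  rw [Matrix.isSymmetric_toEuclideanLin_iff, Matrix.IsHermitian,
    Matrix.conjTranspose_eq_transpose_of_trivial]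
  exact hW

/-- If the noise matrix is large, then so is the Rayleigh quotient near an eigenvector. -/
lemma exists_ball_rayleigh_ge {n : ℕ} (hn : 0 < n) (g : LowerIdx n → ℝ) {κ : ℝ}
    (hg : ¬ ∀ x : Fin n → ℝ,
      ∑ i, (∑ j, noiseMatrix g i j * x j) ^ 2 ≤ κ ^ 2 * ∑ i, x i ^ 2) :
    ∃ v : EuclideanSpace ℝ (Fin n), ‖v‖ = 1 ∧
      ∀ x ∈ Metric.ball v (1 / 4), 7 / 9 * κ ≤ |rayleigh g x| := by
  have : Nonempty (Fin n) := Fin.pos_iff_nonempty.1 hn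
  have hT := isSymmetric_toEuclideanLin (noiseMatrix_isSymm g)
  obtain ⟨L, v, hL, hTL, hv, hTv⟩ := exists_norm_eigenvector hT
  have hκL : κ ≤ L := by
    by_contra! h
    refine hg fun x => ?_
    have h1 := hTL (WithLp.toLp 2 x)
    have h2 : ‖(noiseMatrix g).toEuclideanLin (WithLp.toLp 2 x)‖ ^ 2
        ≤ κ ^ 2 * ‖WithLp.toLp 2 x‖ ^ 2 := by
      rw [← mul_pow]
      gcongr
      exact h1.trans (by gcongr)
    simpa [EuclideanSpace.real_norm_sq_eq, Matrix.toLpLin_apply, Matrix.mulVec,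
      dotProduct] using h2
  refine ⟨v, hv, fun x hx => ?_⟩
  have hx0 : 0 < ‖x‖ ^ 2 := by
    have : x ≠ 0 := by
      rintro rfl
      rw [mem_ball_iff_norm, zero_sub, norm_neg, hv] at hx
      norm_num at hx
    positivity
  refine le_of_mul_le_mul_right ?_ hx0
  refine le_trans (b := 7 / 9 * L * ‖x‖ ^ 2) (by gcongr) ?_
  rcases hTv with hTv | hTv
  · refine (inner_ge_of_mem_ball hT hL hTL hv hTv hx).trans ?_
    rw [inner_eq_rayleigh]
    gcongr
    exact le_abs_self _
  · have := inner_ge_of_mem_ball (T := -(noiseMatrix g).toEuclideanLin) (fun x y => by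
      simp only [LinearMap.neg_apply, inner_neg_left, inner_neg_right, hT x y]) hL
      (fun x => by simpa using hTL x) hv (by simp [hTv]) hx
    refine this.trans ?_
    rw [LinearMap.neg_apply, inner_neg_left, inner_eq_rayleigh, ← neg_mul]
    gcongr
    exact neg_le_abs _

/-- The noise matrix has operator norm at most `4 √n` with overwhelming probability. -/
theorem noiseLaw_norm_gt_le {n : ℕ} (hn : 0 < n) :
    noiseLaw n {g | ¬ ∀ x : Fin n → ℝ,
      ∑ i, (∑ j, noiseMatrix g i j * x j) ^ 2 ≤ (4 * √n) ^ 2 * ∑ i, x i ^ 2}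
      ≤ ENNReal.ofReal (2 * (5 * Real.exp (-2)) ^ n) := by
  have : Nonempty (Fin n) := Fin.pos_iff_nonempty.1 hn
  have hn0 : (0 : ℝ) ≤ n := n.cast_nonneg
  set V := volume (Metric.ball (0 : EuclideanSpace ℝ (Fin n)) 1) with hV
  have hV0 : V ≠ 0 := (Metric.measure_ball_pos _ _ one_pos).ne'
  have hVt : V ≠ ⊤ := measure_ball_lt_top.ne
  have hvol : ∀ (x : EuclideanSpace ℝ (Fin n)) (r : ℝ), 0 ≤ r →
      volume (Metric.ball x r) = ENNReal.ofReal (r ^ n) * V := fun x r hr => by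
    rw [Measure.addHaar_ball _ _ hr, finrank_euclideanSpace_fin]
  -- The radius `5/4` contains every ball of radius `1/4` about a unit vector.
  set F : (LowerIdx n → ℝ) → ENNReal := fun g =>
    ∫⁻ x in Metric.ball 0 (5 / 4), expRayleigh √n g x with hF
  have hFm : Measurable F := (measurable_expRayleigh n √n).lintegral_prod_right'
  have hup : ∫⁻ g, F g ∂noiseLaw n
      ≤ ENNReal.ofReal (2 * Real.exp n) * (ENNReal.ofReal ((5 / 4) ^ n) * V) := by
    rw [hF, lintegral_lintegral_swap (measurable_expRayleigh n √n).aemeasurable]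
    refine (lintegral_mono fun x => lintegral_expRayleigh_le √n x).trans ?_
    rw [lintegral_const, Measure.restrict_apply_univ, hvol _ _ (by norm_num),
      Real.sq_sqrt hn0]
  set c := ENNReal.ofReal (Real.exp (3 * n)) * (ENNReal.ofReal ((1 / 4) ^ n) * V) with hc
  have hlow : ∀ g : LowerIdx n → ℝ, (¬ ∀ x : Fin n → ℝ,
      ∑ i, (∑ j, noiseMatrix g i j * x j) ^ 2 ≤ (4 * √n) ^ 2 * ∑ i, x i ^ 2) → c ≤ F g := by
    intro g hg
    obtain ⟨v, hv, hball⟩ := exists_ball_rayleigh_ge hn g hg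
    have hsub : Metric.ball v (1 / 4) ⊆ Metric.ball (0 : EuclideanSpace ℝ (Fin n)) (5 / 4) :=
      Metric.ball_subset_ball' (by rw [dist_zero_right, hv]; norm_num)
    calc c = ∫⁻ _ in Metric.ball v (1 / 4), ENNReal.ofReal (Real.exp (3 * n)) := by
          rw [lintegral_const, Measure.restrict_apply_univ, hvol _ _ (by norm_num)]
      _ ≤ ∫⁻ x in Metric.ball v (1 / 4), expRayleigh √n g x := by
          refine setLIntegral_mono' measurableSet_ball fun x hx => ?_
          -- Here `7/9 * 4 = 28/9 ≥ 3`.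
          have h1 : 3 * n ≤ √n * |rayleigh g x| := by
            have h2 := mul_le_mul_of_nonneg_left (hball x hx) (Real.sqrt_nonneg n)
            nlinarith [Real.mul_self_sqrt hn0]
          unfold expRayleigh
          rcases abs_choice (rayleigh g x) with h | h <;> rw [h] at h1
          · exact le_add_right (ENNReal.ofReal_le_ofReal (Real.exp_le_exp.2 h1))
          · exact le_add_left (ENNReal.ofReal_le_ofReal (Real.exp_le_exp.2 (by linarith)))
      _ ≤ F g := lintegral_mono_set hsub
  have hmark := (mul_le_mul_right (measure_mono fun g hg => hlow g hg) c).trans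
    ((mul_meas_ge_le_lintegral hFm c).trans hup)
  have hc0 : c ≠ 0 := by
    refine mul_ne_zero ?_ (mul_ne_zero ?_ hV0) <;>
      exact (ENNReal.ofReal_pos.2 (by positivity)).ne'
  have hct : c ≠ ⊤ := by finiteness
  -- The volume ratio `5ⁿ` meets the exponential ratio `e^(n - 3n)`; the bound decays because `5 <
  -- e²`.
  have hfin : ENNReal.ofReal (2 * Real.exp n) * (ENNReal.ofReal ((5 / 4) ^ n) * V)
      = c * ENNReal.ofReal (2 * (5 * Real.exp (-2)) ^ n) := by
    rw [hc, mul_right_comm, ← mul_assoc, ← mul_assoc,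
      mul_right_comm _ _ (ENNReal.ofReal ((1 / 4) ^ n)), ← ENNReal.ofReal_mul (by positivity), ← ENNReal.ofReal_mul (by positivity),
      ← ENNReal.ofReal_mul (by positivity)]
    congr 2
    have e1 : Real.exp n = Real.exp (3 * n) * Real.exp (-2) ^ n := by
      rw [← Real.exp_nat_mul, ← Real.exp_add]
      congr 1
      ring
    have e2 : ((5 : ℝ) / 4) ^ n = (1 / 4) ^ n * 5 ^ n := by
      rw [← mul_pow]
      norm_num
    rw [e1, e2, mul_pow]
    ring
  rw [hfin] at hmark
  exact (ENNReal.mul_le_mul_iff_right hc0 hct).1 hmark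

lemma tendsto_noiseLaw_norm_gt :
    Tendsto (fun n => noiseLaw n {g | ¬ ∀ x : Fin n → ℝ,
      ∑ i, (∑ j, noiseMatrix g i j * x j) ^ 2 ≤ (4 * √n) ^ 2 * ∑ i, x i ^ 2})
      atTop (𝓝 0) := by
  have h5 : 5 * Real.exp (-2) < 1 := by
    rw [Real.exp_neg, mul_inv_lt_iff₀ (Real.exp_pos 2), one_mul,
      show (2 : ℝ) = 1 + 1 by norm_num, Real.exp_add]
    nlinarith [Real.exp_one_gt_d9]
  have hlim : Tendsto (fun n : ℕ => ENNReal.ofReal (2 * (5 * Real.exp (-2)) ^ n))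
      atTop (𝓝 0) := by
    rw [← ENNReal.ofReal_zero]
    refine ENNReal.tendsto_ofReal ?_
    simpa using (tendsto_pow_atTop_nhds_zero_of_lt_one (by positivity) h5).const_mul 2
  refine tendsto_of_tendsto_of_tendsto_of_le_of_le' tendsto_const_nhds hlim
    (Eventually.of_forall fun _ => zero_le) ?_
  filter_upwards [eventually_gt_atTop 0] with n hn using noiseLaw_norm_gt_le hn

/-! ### From the norm bound to both normalizations. -/

/-- A property of the noise matrices which holds whenever their operator norm is at most `4 √n`
holds with high probability. -/
lemma withHighProbability_of_norm_le {good : ∀ n : ℕ, Matrix (Fin n) (Fin n) ℝ → Prop}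
    (h : ∀ n, 0 < n → ∀ W : Matrix (Fin n) (Fin n) ℝ, W.IsSymm → (∀ i, W i i = 0) →
      (∀ x : Fin n → ℝ, ∑ i, (∑ j, W i j * x j) ^ 2 ≤ (4 * √n) ^ 2 * ∑ i, x i ^ 2) →
      good n W) : WithHighProbability good := by
  refine tendsto_of_tendsto_of_tendsto_of_le_of_le' tendsto_const_nhds
    tendsto_noiseLaw_norm_gt (Eventually.of_forall fun _ => zero_le) ?_
  filter_upwards [eventually_gt_atTop 0] with n hn
  exact measure_mono fun g hg hg' =>
    hg (h n hn _ (noiseMatrix_isSymm g) (noiseMatrix_diag g) hg')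

lemma sum_sq_smul_le {n : ℕ} {W : Matrix (Fin n) (Fin n) ℝ} {κ : ℝ} (r : ℝ)
    (hW : ∀ x : Fin n → ℝ, ∑ i, (∑ j, W i j * x j) ^ 2 ≤ κ ^ 2 * ∑ i, x i ^ 2)
    (x : Fin n → ℝ) :
    ∑ i, (∑ j, (r • W) i j * x j) ^ 2 ≤ (r * κ) ^ 2 * ∑ i, x i ^ 2 := by
  simp only [Matrix.smul_apply, smul_eq_mul, mul_assoc, ← Finset.mul_sum, mul_pow]
  exact mul_le_mul_of_nonneg_left (hW x) (sq_nonneg r)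

end Z2Sync

theorem mainTheorem5 (ε : ℝ) (hε : 0 < ε)
    (z : ∀ n : ℕ, Fin n → ℝ) (hz : ∀ n i, z n i = 1 ∨ z n i = -1) :
    (∀ lam : ℕ → ℝ, (∀ n, 1 ≤ n → 16 < lam n) →
      Z2Sync.WithHighProbability fun n W =>
        ∀ Q : Matrix (Fin n) (Fin 2) ℝ,
          Z2Sync.IsSecondOrderCritical (Z2Sync.scaledObs (lam n) (z n) W) Q →
            Z2Sync.correlation Q (z n) ≥ 1 - (1 + ε) * (16 / lam n)) ∧
    (∀ σ : ℕ → ℝ, (∀ n, 1 ≤ n → 0 < σ n ∧ σ n < 1 / 16 * Real.sqrt n) →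
      Z2Sync.WithHighProbability fun n W =>
        ∀ Q : Matrix (Fin n) (Fin 2) ℝ,
          Z2Sync.IsSecondOrderCritical (Z2Sync.obs (σ n) (z n) W) Q →
            Z2Sync.correlation Q (z n) ≥ 1 - (1 + ε) * (16 * σ n / Real.sqrt n)) := by
  constructor
  · intro lam hlam
    refine Z2Sync.withHighProbability_of_norm_le fun n hn W hWs hWd hW Q hQ => ?_
    have hl := hlam n hn
    have hn' : (0 : ℝ) < n := by exact_mod_cast hn
    have hs : 0 < √(n : ℝ) := Real.sqrt_pos.2 hn'
    have hκ : 1 / √(n : ℝ) * (4 * √n) = 4 := by field_simp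
    have hp : lam n / n * n = lam n := div_mul_cancel₀ _ hn'.ne'
    have := Z2Sync.IsSecondOrderCritical.correlation_ge hn (hz n) (hWs.smul (1 / √(n : ℝ)))
      (fun i => by simp [hWd]) (by positivity) (by rw [hκ, hp]; linarith)
      (Z2Sync.sum_sq_smul_le (1 / √(n : ℝ)) hW) hQ
    rw [hκ, hp] at this
    -- The bound already holds without `ε`, which only weakens it.
    have h16 : 0 ≤ ε * (16 / lam n) := by positivity
    norm_num at this
    linarith
  · intro σ hσ
    refine Z2Sync.withHighProbability_of_norm_le fun n hn W hWs hWd hW Q hQ => ?_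
    obtain ⟨hσ0, hσ1⟩ := hσ n hn
    have hn' : (0 : ℝ) < n := by exact_mod_cast hn
    have hs : 0 < √(n : ℝ) := Real.sqrt_pos.2 hn'
    have hss : √(n : ℝ) * √n = n := Real.mul_self_sqrt hn'.le
    -- The unscaled observation is the case `p = 1`, `κ = 4σ√n`.
    rw [Z2Sync.obs, ← one_smul ℝ (vecMulVec (z n) (z n))] at hQ
    have := Z2Sync.IsSecondOrderCritical.correlation_ge hn (hz n) (hWs.smul (σ n))
      (fun i => by simp [hWd]) (by positivity) (by nlinarith)
      (Z2Sync.sum_sq_smul_le (σ n) hW) hQ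
    have e : 4 * (σ n * (4 * √(n : ℝ))) / (1 * n) = 16 * σ n / √n := by
      rw [div_eq_div_iff (by positivity) (by positivity)]
      linear_combination 16 * σ n * hss
    rw [e] at this
    have h16 : 0 ≤ ε * (16 * σ n / √(n : ℝ)) := by positivity
    linarith
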